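/- For $m\in\mathbb{N}$ let $\widehat{\mathbb{Z}}_2^{m}$ be the group of complex characters of $\mathbb{Z}_2^m$. Every such character is a square-free monomial $x\mapsto\prod_{i\in I}(-1)^{x_i}$ with $I\subseteq\{1,\dots,m\}$; its degree is $|I|$. For a finite abelian group $G$ and $g:G\to\mathbb{C}$, let $\operatorname{supp}(g)$ be the set of characters $\chi$ of $G$ with $\widehat g(\chi)=\frac1{|G|}\sum_{x\in G}g(x)\overline{\chi(x)}\neq 0$. A function $f:G\to\mathbb{R}$ has an SOS certificate with support $T\subseteq\widehat G$ if there are finitely many functions $h_1,\dots,h_k:G\to\mathbb{C}$ with $\operatorname{supp}(h_i)\subseteq T$ for all $i$ and $f=\sum_{i=1}^k|h_i|^2$. **Theorem.** Let $f:\mathbb{Z}_2^n\to\mathbb{R}$ be nonnegative. Let $m_1,m_2,d\in\mathbb{N}$ (zero allowed) with $m_1+m_2=n$, and identify $\mathbb{Z}_2^n=\mathbb{Z}_2^{m_1}\times\mathbb{Z}_2^{m_2}$ (first $m_1$ and last $m_2$ coordinates), so that $\widehat{\mathbb{Z}}_2^{n}=\widehat{\mathbb{Z}}_2^{m_1}\times\widehat{\mathbb{Z}}_2^{m_2}$.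 Suppose that $\operatorname{supp}(f)\subseteq S_1\times S_2$, where $S_1=\{\chi\in\widehat{\mathbb{Z}}_2^{m_1}:\deg(\chi)\le d\}$ and $S_2\subseteq\widehat{\mathbb{Z}}_2^{m_2}$ is arbitrary. Then $f$ has an SOS certificate with support $$T=\Big\{\chi\in\widehat{\mathbb{Z}}_2^{m_1}:\deg(\chi)\le\Big\lceil\tfrac{m_1+d-1}{2}\Big\rceil\Big\}\times\widehat H,$$ where $\widehat H$ is the subgroup of $\widehat{\mathbb{Z}}_2^{m_2}$ generated by $S_2$. -/

import Mathlib

/-- The Fourier coefficient `(1/|G|) ∑ₓ f(x) · conj (χ x)` of `f : G → ℂ` at the character `χ`. -/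
noncomputable def charCoeff {G : Type*} [AddCommGroup G] [Fintype G]
    (f : G → ℂ) (χ : AddChar G ℂ) : ℂ :=
  (Fintype.card G : ℂ)⁻¹ * ∑ x, f x * (starRingEnd ℂ) (χ x)

/-- The set of characters at which the Fourier coefficient of `f` does not vanish. -/
def charSupp {G : Type*} [AddCommGroup G] [Fintype G] (f : G → ℂ) : Set (AddChar G ℂ) :=
  {χ | charCoeff f χ ≠ 0}

/-- `f` has a (Fourier) sum-of-squares certificate with support `T`: `f = ∑ |hᵢ|²` for finitely
many functions `hᵢ : G → ℂ`, in whose Fourier expansions only characters from `T` occur. -/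
def HasFSOS {G : Type*} [AddCommGroup G] [Fintype G] (f : G → ℝ) (T : Set (AddChar G ℂ)) : Prop :=
  ∃ (k : ℕ) (h : Fin k → G → ℂ),
    (∀ i, charSupp (h i) ⊆ T) ∧ ∀ x, f x = ∑ i, ‖h i x‖ ^ 2

open Classical in
/-- The variables that occur in the square-free monomial `χ`
(see `apply_eq_prod_charVars`), for a character `χ` of `ℤ₂ᵐ`. -/
noncomputable def charVars {m : ℕ} (χ : AddChar (Fin m → ZMod 2) ℂ) : Finset (Fin m) :=
  Finset.univ.filter fun i => χ (Pi.single i 1) ≠ 1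

/-- The degree of a character of `ℤ₂ᵐ`, seen as a square-free monomial in `m` variables. -/
noncomputable def charDeg {m : ℕ} (χ : AddChar (Fin m → ZMod 2) ℂ) : ℕ :=
  (charVars χ).card

/-- Every character of `ℤ₂ᵐ` is the product of the coordinate characters `x ↦ (-1) ^ xᵢ` over the
variables `i` that occur in it. -/
theorem apply_eq_prod_charVars {m : ℕ} (χ : AddChar (Fin m → ZMod 2) ℂ) (x : Fin m → ZMod 2) :
    χ x = ∏ i ∈ charVars χ, (-1 : ℂ) ^ (x i).val := by
  classical
  have hx : x = ∑ i, Pi.single i (x i) := (Finset.univ_sum_single x).symm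
  have key : ∀ i, χ (Pi.single i (x i)) =
      if χ (Pi.single i 1) ≠ 1 then (-1 : ℂ) ^ (x i).val else 1 := by
    intro i
    have hsq : χ (Pi.single i 1) * χ (Pi.single i 1) = 1 := by
      rw [← AddChar.map_add_eq_mul, ← Pi.single_add]
      have : (1 + 1 : ZMod 2) = 0 := by decide
      rw [this, Pi.single_zero, AddChar.map_zero_eq_one]
    have h01 : ∀ a : ZMod 2, a = 0 ∨ a = 1 := by decide
    rcases h01 (x i) with h | h
    · simp [h]
    · rcases mul_self_eq_one_iff.mp hsq with h1 | h1
      · simp [h, h1]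
      · have hne : (-1 : ℂ) ≠ 1 := by norm_num
        simp [h, h1, hne, ZMod.val_one]
  have hprod : χ (∑ i, Pi.single i (x i)) = ∏ i, χ (Pi.single i (x i)) :=
    map_sum χ.toAddMonoidHom _ _
  conv_lhs => rw [hx]
  rw [hprod, Finset.prod_congr rfl fun i _ => key i, ← Finset.prod_filter]
  rfl

/-- The projection of `ℤ₂ⁿ = ℤ₂^m₁ × ℤ₂^m₂` to the first `m₁` coordinates. -/
def projFirst {n m₁ m₂ : ℕ} (hn : m₁ + m₂ = n) : (Fin n → ZMod 2) →+ (Fin m₁ → ZMod 2) where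
  toFun x := fun i => x (Fin.cast hn (Fin.castAdd m₂ i))
  map_zero' := rfl
  map_add' _ _ := rfl

/-- The projection of `ℤ₂ⁿ = ℤ₂^m₁ × ℤ₂^m₂` to the last `m₂` coordinates. -/
def projLast {n m₁ m₂ : ℕ} (hn : m₁ + m₂ = n) : (Fin n → ZMod 2) →+ (Fin m₂ → ZMod 2) where
  toFun x := fun i => x (Fin.cast hn (Fin.natAdd m₁ i))
  map_zero' := rfl
  map_add' _ _ := rfl

/-- The product set `A × B`, as a set of characters of `ℤ₂ⁿ = ℤ₂^m₁ × ℤ₂^m₂`: the pair `(χ₁, χ₂)`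
is the character `(y, z) ↦ χ₁ y * χ₂ z`. -/
def charProd {n m₁ m₂ : ℕ} (hn : m₁ + m₂ = n)
    (A : Set (AddChar (Fin m₁ → ZMod 2) ℂ)) (B : Set (AddChar (Fin m₂ → ZMod 2) ℂ)) :
    Set (AddChar (Fin n → ZMod 2) ℂ) :=
  {χ | ∃ χ₁ ∈ A, ∃ χ₂ ∈ B, ∀ x, χ x = χ₁ (projFirst hn x) * χ₂ (projLast hn x)}

section Fourier

variable {G : Type*} [AddCommGroup G] [Fintype G]

/-! For a group `K` of characters containing the support of `f`, the vectors `v_s = √f · s̄`, `s ∈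
K`, have Gram entries `|G| · f̂(t / s)`, and `‖∑ s(x) v_s‖²` is a constant multiple of `f x`
(`norm_sq_sum_gramVec`). Split this sum along `U`, the span of the `v_s` with `s ∉ T`, and `Uᗮ`. The
`Uᗮ` part involves only `s ∈ T`. If `f̂(s / t) = 0` whenever `s ∉ T` and `η * t ∉ T`, the `U` part
involves only `t` with `η * t ∈ T`, and multiplying it by the unimodular `η` moves it into `T`
(`hasFSOS_of_separated`). On the cube, `η` is the product of the first `m₁` variables: it turns
degree `k` into `m₁ - k`, so the forbidden `s` and `t` differ by degree more than `d`. -/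

theorem conj_addChar_apply (χ : AddChar G ℂ) (x : G) :
    (starRingEnd ℂ) (χ x) = χ (-x) :=
  (AddChar.map_neg_eq_conj χ x).symm

/-- Fourier inversion. -/
theorem sum_charCoeff_mul (g : G → ℂ) (x : G) : ∑ χ, charCoeff g χ * χ x = g x := by
  classical
  have hG : (Fintype.card G : ℂ) ≠ 0 := by simp
  have h1 : ∀ χ : AddChar G ℂ, charCoeff g χ * χ x =
      ∑ y, (Fintype.card G : ℂ)⁻¹ * g y * χ (x - y) := by
    intro χ
    rw [charCoeff, mul_assoc, Finset.sum_mul, Finset.mul_sum]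
    refine Finset.sum_congr rfl fun y _ => ?_
    rw [conj_addChar_apply, sub_eq_add_neg, AddChar.map_add_eq_mul]
    ring
  rw [Finset.sum_congr rfl fun χ _ => h1 χ, Finset.sum_comm]
  simp only [← Finset.mul_sum, AddChar.sum_apply_eq_ite, sub_eq_zero]
  rw [Finset.sum_eq_single x (fun y _ hy => by simp [Ne.symm hy]) (by simp)]
  simp only [if_true]
  field_simp

theorem charCoeff_addChar (ψ χ : AddChar G ℂ) (h : ψ ≠ χ) : charCoeff (fun x => ψ x) χ = 0 := by
  have h1 : ∀ x, ψ x * (starRingEnd ℂ) (χ x) = (ψ / χ) x := fun x => by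
    rw [AddChar.div_apply, conj_addChar_apply]
  have h2 : ∑ x, (ψ / χ) x = 0 :=
    AddChar.sum_eq_zero_of_ne_one (div_ne_one.mpr h)
  simp only [charCoeff, h1, h2, mul_zero]

theorem charCoeff_sum {ι : Type*} (F : Finset ι) (c : ι → ℂ) (g : ι → G → ℂ) (χ : AddChar G ℂ) :
    charCoeff (fun x => ∑ s ∈ F, c s * g s x) χ = ∑ s ∈ F, c s * charCoeff (g s) χ := by
  simp only [charCoeff, Finset.sum_mul, Finset.mul_sum]
  rw [Finset.sum_comm]
  refine Finset.sum_congr rfl fun s _ => Finset.sum_congr rfl fun x _ => ?_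
  ring

theorem charSupp_sum_subset {F : Finset (AddChar G ℂ)} {c : AddChar G ℂ → ℂ} {η : AddChar G ℂ}
    {T : Set (AddChar G ℂ)} (hT : ∀ s ∈ F, c s ≠ 0 → η * s ∈ T) :
    charSupp (fun x => ∑ s ∈ F, c s * (η * s) x) ⊆ T := by
  intro χ hχ
  rw [charSupp, Set.mem_ofPred_eq, charCoeff_sum F c fun s x => (η * s) x] at hχ
  obtain ⟨s, hs, hne⟩ := Finset.exists_ne_zero_of_sum_ne_zero hχ
  have h1 : η * s = χ := by
    by_contra h
    exact hne (by rw [charCoeff_addChar _ _ h, mul_zero])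
  exact h1 ▸ hT s hs (left_ne_zero_of_mul hne)

theorem HasFSOS.of_fintype {ι : Type*} [Fintype ι] {f : G → ℝ} {T : Set (AddChar G ℂ)}
    (h : ι → G → ℂ) (hT : ∀ i, charSupp (h i) ⊆ T) (hf : ∀ x, f x = ∑ i, ‖h i x‖ ^ 2) :
    HasFSOS f T := by
  refine ⟨Fintype.card ι, fun i => h ((Fintype.equivFin ι).symm i), fun i => hT _, fun x => ?_⟩
  rw [hf x]
  exact ((Fintype.equivFin ι).symm.sum_comp fun i => ‖h i x‖ ^ 2).symm

open Classical in
/-- The finite set of elements of a group of characters. -/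
noncomputable def charFinset (K : Subgroup (AddChar G ℂ)) : Finset (AddChar G ℂ) :=
  Finset.univ.filter (· ∈ K)

theorem mem_charFinset {K : Subgroup (AddChar G ℂ)} {χ : AddChar G ℂ} :
    χ ∈ charFinset K ↔ χ ∈ K := by
  simp [charFinset]

theorem card_charFinset_pos (K : Subgroup (AddChar G ℂ)) : 0 < (charFinset K).card :=
  Finset.card_pos.mpr ⟨1, mem_charFinset.mpr K.one_mem⟩

/-- Dividing by a fixed `t ∈ K` permutes `K`, so each of the `|K|` terms of the conjugate factor
contributes the same sum. -/
theorem sum_charFinset_mul_conj (K : Subgroup (AddChar G ℂ)) (z : G) :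
    (∑ s ∈ charFinset K, s z) * (starRingEnd ℂ) (∑ s ∈ charFinset K, s z) =
      (charFinset K).card * ∑ s ∈ charFinset K, s z := by
  rw [map_sum, Finset.mul_sum, ← nsmul_eq_mul]
  refine Finset.sum_eq_card_nsmul fun t ht => ?_
  rw [Finset.sum_mul]
  have htK := mem_charFinset.mp ht
  refine Finset.sum_bij' (fun s _ => s / t) (fun s _ => s * t)
    (fun s hs => mem_charFinset.mpr (K.div_mem (mem_charFinset.mp hs) htK))
    (fun s hs => mem_charFinset.mpr (K.mul_mem (mem_charFinset.mp hs) htK))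
    (fun s _ => div_mul_cancel s t) (fun s _ => mul_div_cancel_right s t) fun s _ => ?_
  rw [AddChar.div_apply, conj_addChar_apply]

/-- The vectors `√f · s̄`, whose Gram matrix is `(|G| · f̂(s / t))`. -/
noncomputable def gramVec (f : G → ℝ) (s : AddChar G ℂ) : EuclideanSpace ℂ G :=
  WithLp.toLp 2 fun y => (Real.sqrt (f y) : ℂ) * (starRingEnd ℂ) (s y)

theorem inner_gramVec {f : G → ℝ} (hf : ∀ x, 0 ≤ f x) (s t : AddChar G ℂ) :
    inner ℂ (gramVec f s) (gramVec f t) =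
      Fintype.card G * charCoeff (fun x => (f x : ℂ)) (t / s) := by
  have hG : (Fintype.card G : ℂ) ≠ 0 := by simp
  rw [charCoeff, mul_inv_cancel_left₀ hG, PiLp.inner_apply]
  refine Finset.sum_congr rfl fun y _ => ?_
  have h2 : (Real.sqrt (f y) : ℂ) * Real.sqrt (f y) = f y := by
    rw [← Complex.ofReal_mul, Real.mul_self_sqrt (hf y)]
  simp only [gramVec, RCLike.inner_apply, map_mul, Complex.conj_ofReal, AddChar.div_apply,
    conj_addChar_apply, neg_neg, ← h2]
  ring

theorem norm_sq_sum_gramVec {f : G → ℝ} (hf : ∀ x, 0 ≤ f x) (K : Subgroup (AddChar G ℂ))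
    (hK : charSupp (fun x => (f x : ℂ)) ⊆ K) (x : G) :
    ‖∑ s ∈ charFinset K, s x • gramVec f s‖ ^ 2 =
      Fintype.card G * (charFinset K).card * f x := by
  have hG : (Fintype.card G : ℂ) ≠ 0 := by simp
  have hinv : ∑ s ∈ charFinset K, charCoeff (fun x => (f x : ℂ)) s * s x = f x := by
    rw [← sum_charCoeff_mul (fun x => (f x : ℂ)) x]
    refine Finset.sum_subset (Finset.subset_univ _) fun s _ hs => ?_
    have : charCoeff (fun x => (f x : ℂ)) s = 0 := by
      by_contra h
      exact hs (mem_charFinset.mpr (hK h))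
    rw [this, zero_mul]
  have hcoord : ∀ y, (∑ s ∈ charFinset K, s x • gramVec f s) y =
      Real.sqrt (f y) * ∑ s ∈ charFinset K, s (x - y) := by
    intro y
    rw [WithLp.ofLp_sum, Finset.sum_apply, Finset.mul_sum]
    refine Finset.sum_congr rfl fun s _ => ?_
    simp only [gramVec, PiLp.smul_apply, smul_eq_mul, conj_addChar_apply, sub_eq_add_neg,
      AddChar.map_add_eq_mul]
    ring
  have hsq : ∀ y, ((‖(∑ s ∈ charFinset K, s x • gramVec f s) y‖ ^ 2 : ℝ) : ℂ) =
      (charFinset K).card * ∑ s ∈ charFinset K, f y * s (x - y) := by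
    intro y
    have h2 : (Real.sqrt (f y) : ℂ) * Real.sqrt (f y) = f y := by
      rw [← Complex.ofReal_mul, Real.mul_self_sqrt (hf y)]
    rw [Complex.ofReal_pow, ← Complex.mul_conj', hcoord, map_mul, Complex.conj_ofReal,
      mul_mul_mul_comm, h2, sum_charFinset_mul_conj, ← Finset.mul_sum]
    ring
  -- Summing over `y` convolves `f` with the kernel `∑ s ∈ K, s`, which reproduces `f` up to the
  -- factor `|G|` because the support of `f` lies in `K`.
  have hC : ((‖∑ s ∈ charFinset K, s x • gramVec f s‖ ^ 2 : ℝ) : ℂ) =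
      ((Fintype.card G * (charFinset K).card * f x : ℝ) : ℂ) := by
    rw [EuclideanSpace.norm_sq_eq, Complex.ofReal_sum]
    simp only [hsq]
    rw [← Finset.mul_sum, Finset.sum_comm]
    push_cast
    rw [← hinv, mul_comm (Fintype.card G : ℂ), mul_assoc]
    refine congrArg _ ?_
    rw [Finset.mul_sum]
    refine Finset.sum_congr rfl fun s _ => ?_
    rw [charCoeff, mul_assoc, mul_inv_cancel_left₀ hG, Finset.sum_mul]
    refine Finset.sum_congr rfl fun y _ => ?_
    rw [conj_addChar_apply, sub_eq_add_neg, AddChar.map_add_eq_mul]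
    ring
  exact Complex.ofReal_injective hC

/-- If the group `K` of characters is covered by `T` and the translate `η⁻¹ T`, and no Fourier
coefficient of `f` joins the two set differences, then `f` has an SOS certificate with
support `T`. -/
theorem hasFSOS_of_separated {f : G → ℝ} (hf : ∀ x, 0 ≤ f x) (K : Subgroup (AddChar G ℂ))
    (hK : charSupp (fun x => (f x : ℂ)) ⊆ K) (T : Set (AddChar G ℂ)) (η : AddChar G ℂ)
    (hsep : ∀ s ∈ K, ∀ t ∈ K, s ∉ T → η * t ∉ T →
      charCoeff (fun x => (f x : ℂ)) (s / t) = 0) :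
    HasFSOS f T := by
  let U : Submodule ℂ (EuclideanSpace ℂ G) := Submodule.span ℂ (gramVec f '' {s | s ∈ K ∧ s ∉ T})
  have hin : ∀ s ∈ K, s ∉ T → Uᗮ.starProjection (gramVec f s) = 0 := by
    intro s hs hsT
    rw [Submodule.starProjection_apply_eq_zero_iff]
    exact Submodule.le_orthogonal_orthogonal U (Submodule.subset_span ⟨s, ⟨hs, hsT⟩, rfl⟩)
  have hout : ∀ t ∈ K, η * t ∉ T → U.starProjection (gramVec f t) = 0 := by
    intro t ht htT
    rw [Submodule.starProjection_apply_eq_zero_iff, Submodule.mem_orthogonal']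
    intro u hu
    induction hu using Submodule.span_induction with
    | mem u hu =>
      obtain ⟨s, ⟨hs, hsT⟩, rfl⟩ := hu
      rw [inner_gramVec hf, hsep s hs t ht hsT htT, mul_zero]
    | zero => exact inner_zero_right _
    | add u v _ _ h1 h2 => rw [inner_add_right, h1, h2, add_zero]
    | smul a u _ h1 => rw [inner_smul_right, h1, mul_zero]
  let N : ℝ := Fintype.card G * (charFinset K).card
  have hN : 0 < N := mul_pos (by exact_mod_cast Fintype.card_pos)
    (by exact_mod_cast card_charFinset_pos K)
  let c : ℂ := ((Real.sqrt N)⁻¹ : ℝ)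
  have hc : ‖c‖ ^ 2 = N⁻¹ := by
    rw [Complex.norm_real, Real.norm_eq_abs, sq_abs, inv_pow, Real.sq_sqrt hN.le]
  -- The squares are the coordinates `y` of the projected sum, twisted by `θ`; the twist leaves
  -- absolute values unchanged.
  let F : Submodule ℂ (EuclideanSpace ℂ G) → AddChar G ℂ → G → G → ℂ := fun V θ y x =>
    ∑ s ∈ charFinset K, (c * (V.starProjection (gramVec f s)) y) * (θ * s) x
  have hF : ∀ (V : Submodule ℂ (EuclideanSpace ℂ G)) θ x, ∑ y, ‖F V θ y x‖ ^ 2 =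
      N⁻¹ * ‖V.starProjection (∑ s ∈ charFinset K, s x • gramVec f s)‖ ^ 2 := by
    intro V θ x
    rw [EuclideanSpace.norm_sq_eq, Finset.mul_sum]
    refine Finset.sum_congr rfl fun y _ => ?_
    have h1 : F V θ y x =
        c * θ x * (V.starProjection (∑ s ∈ charFinset K, s x • gramVec f s)) y := by
      rw [map_sum, WithLp.ofLp_sum, Finset.sum_apply, Finset.mul_sum]
      refine Finset.sum_congr rfl fun s _ => ?_
      rw [map_smul, PiLp.smul_apply, smul_eq_mul, AddChar.mul_apply]
      ring
    rw [h1, norm_mul, norm_mul, AddChar.norm_apply, mul_one, mul_pow, hc]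
  refine HasFSOS.of_fintype (ι := G ⊕ G) (Sum.elim (F Uᗮ 1) (F U η)) ?_ fun x => ?_
  · rintro (y | y)
    · refine charSupp_sum_subset fun s hs hne => ?_
      by_contra h
      rw [one_mul] at h
      exact hne (by rw [hin s (mem_charFinset.mp hs) h]; simp)
    · refine charSupp_sum_subset fun s hs hne => ?_
      by_contra h
      exact hne (by rw [hout s (mem_charFinset.mp hs) h]; simp)
  · rw [Fintype.sum_sum_type]
    simp only [Sum.elim_inl, Sum.elim_inr]
    rw [hF, hF, ← mul_add, add_comm, ← Submodule.norm_sq_eq_add_norm_sq_starProjection,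
      norm_sq_sum_gramVec hf K hK x]
    exact (inv_mul_cancel_left₀ hN.ne' (f x)).symm

end Fourier

/-! ### Degrees of characters of the cube -/

section Cube

variable {m : ℕ}

theorem mem_charVars {χ : AddChar (Fin m → ZMod 2) ℂ} {i : Fin m} :
    i ∈ charVars χ ↔ χ (Pi.single i 1) ≠ 1 := by
  simp [charVars]

theorem apply_single_of_mem_charVars {χ : AddChar (Fin m → ZMod 2) ℂ} {i : Fin m}
    (h : i ∈ charVars χ) : χ (Pi.single i 1) = -1 := by
  classical
  rw [apply_eq_prod_charVars, Finset.prod_eq_single i]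
  · simp [ZMod.val_one]
  · intro j _ hj
    simp [Pi.single_eq_of_ne hj]
  · exact fun h' => absurd h h'

/-- A variable of `χ` absent from `ψ` must occur in `χ / ψ`. -/
theorem charDeg_le_add_charDeg_div (χ ψ : AddChar (Fin m → ZMod 2) ℂ) :
    charDeg χ ≤ charDeg ψ + charDeg (χ / ψ) := by
  classical
  refine (Finset.card_le_card fun i hi => ?_).trans (Finset.card_union_le _ _)
  rw [Finset.mem_union]
  by_contra! h
  simp only [mem_charVars, not_not] at h hi
  obtain ⟨h1, h2⟩ := h
  rw [AddChar.div_apply', h1, div_one] at h2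
  exact hi h2

/-- The product `x ↦ ∏ᵢ (-1) ^ xᵢ` of all variables. -/
noncomputable def fullChar (m : ℕ) : AddChar (Fin m → ZMod 2) ℂ :=
  (AddChar.zmodChar 2 (show (-1 : ℂ) ^ 2 = 1 by norm_num)).compAddMonoidHom
    (∑ i, Pi.evalAddMonoidHom (fun _ : Fin m => ZMod 2) i)

theorem fullChar_single (i : Fin m) : fullChar m (Pi.single i 1) = -1 := by
  simp [fullChar, AddChar.zmodChar_apply, ZMod.val_one]

/-- Multiplying by all variables complements the variable set, since squares cancel. -/
theorem charDeg_fullChar_mul_add (χ : AddChar (Fin m → ZMod 2) ℂ) :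
    charDeg (fullChar m * χ) + charDeg χ = m := by
  classical
  have h : charVars (fullChar m * χ) = (charVars χ)ᶜ := by
    ext i
    rw [Finset.mem_compl]
    by_cases hi : i ∈ charVars χ
    · simp [mem_charVars (χ := fullChar m * χ), AddChar.mul_apply, fullChar_single,
        apply_single_of_mem_charVars hi, hi]
    · have h1 : χ (Pi.single i 1) = 1 := by simpa [mem_charVars] using hi
      have h2 : (-1 : ℂ) ≠ 1 := by norm_num
      simp [mem_charVars (χ := fullChar m * χ), AddChar.mul_apply, fullChar_single, h1, hi, h2]
  rw [charDeg, charDeg, h, add_comm, Finset.card_add_card_compl, Fintype.card_fin]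

end Cube

/-! ### Splitting characters into two blocks -/

section Product

/-- The inclusion of `ℤ₂^m₁` into `ℤ₂^m₁ × ℤ₂^m₂`. -/
def inclFirst (m₁ m₂ : ℕ) : (Fin m₁ → ZMod 2) →+ (Fin (m₁ + m₂) → ZMod 2) where
  toFun y := Fin.append y 0
  map_zero' := by
    funext i
    refine Fin.addCases (fun i => ?_) (fun i => ?_) i <;> simp
  map_add' y z := by
    funext i
    refine Fin.addCases (fun i => ?_) (fun i => ?_) i <;> simp

/-- The inclusion of `ℤ₂^m₂` into `ℤ₂^m₁ × ℤ₂^m₂`. -/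
def inclLast (m₁ m₂ : ℕ) : (Fin m₂ → ZMod 2) →+ (Fin (m₁ + m₂) → ZMod 2) where
  toFun y := Fin.append 0 y
  map_zero' := by
    funext i
    refine Fin.addCases (fun i => ?_) (fun i => ?_) i <;> simp
  map_add' y z := by
    funext i
    refine Fin.addCases (fun i => ?_) (fun i => ?_) i <;> simp

variable {m₁ m₂ : ℕ}

theorem mem_charProd_iff {A : Set (AddChar (Fin m₁ → ZMod 2) ℂ)}
    {B : Set (AddChar (Fin m₂ → ZMod 2) ℂ)} {χ : AddChar (Fin (m₁ + m₂) → ZMod 2) ℂ} :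
    χ ∈ charProd rfl A B ↔ χ.compAddMonoidHom (inclFirst m₁ m₂) ∈ A ∧
      χ.compAddMonoidHom (inclLast m₁ m₂) ∈ B := by
  have hff : ∀ y, projFirst rfl (inclFirst m₁ m₂ y) = y := fun y => by
    funext i; simp [projFirst, inclFirst]
  have hlf : ∀ y, projLast rfl (inclFirst m₁ m₂ y) = 0 := fun y => by
    funext i; simp [projLast, inclFirst]
  have hfl : ∀ y, projFirst rfl (inclLast m₁ m₂ y) = 0 := fun y => by
    funext i; simp [projFirst, inclLast]
  have hll : ∀ y, projLast rfl (inclLast m₁ m₂ y) = y := fun y => by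
    funext i; simp [projLast, inclLast]
  constructor
  · rintro ⟨χ₁, h₁, χ₂, h₂, h⟩
    have e₁ : χ.compAddMonoidHom (inclFirst m₁ m₂) = χ₁ := by
      ext y
      rw [AddChar.compAddMonoidHom_apply, h, hff, hlf, AddChar.map_zero_eq_one, mul_one]
    have e₂ : χ.compAddMonoidHom (inclLast m₁ m₂) = χ₂ := by
      ext y
      rw [AddChar.compAddMonoidHom_apply, h, hfl, hll, AddChar.map_zero_eq_one, one_mul]
    exact ⟨e₁ ▸ h₁, e₂ ▸ h₂⟩
  · rintro ⟨h₁, h₂⟩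
    refine ⟨_, h₁, _, h₂, fun x => ?_⟩
    rw [AddChar.compAddMonoidHom_apply, AddChar.compAddMonoidHom_apply,
      ← AddChar.map_add_eq_mul]
    congr 1
    funext i
    refine Fin.addCases (fun i => ?_) (fun i => ?_) i <;>
      simp [inclFirst, inclLast, projFirst, projLast]

/-- The characters of `ℤ₂^m₁ × ℤ₂^m₂` whose second component lies in `H`. -/
def lastSubgroup (m₁ : ℕ) (H : Subgroup (AddChar (Fin m₂ → ZMod 2) ℂ)) :
    Subgroup (AddChar (Fin (m₁ + m₂) → ZMod 2) ℂ) where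
  carrier := {χ | χ.compAddMonoidHom (inclLast m₁ m₂) ∈ H}
  mul_mem' ha hb := H.mul_mem ha hb
  one_mem' := H.one_mem
  inv_mem' {χ} h := by
    have : χ⁻¹.compAddMonoidHom (inclLast m₁ m₂) = (χ.compAddMonoidHom (inclLast m₁ m₂))⁻¹ := by
      ext y
      rw [AddChar.compAddMonoidHom_apply, AddChar.inv_apply', AddChar.inv_apply',
        AddChar.compAddMonoidHom_apply]
    rw [Set.mem_ofPred_eq, this]
    exact H.inv_mem h

end Product

theorem mainTheorem8 (n m₁ m₂ d : ℕ) (hn : m₁ + m₂ = n)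
    (f : (Fin n → ZMod 2) → ℝ) (hf : ∀ x, 0 ≤ f x)
    (S₂ : Set (AddChar (Fin m₂ → ZMod 2) ℂ))
    (hsupp : charSupp (fun x => (f x : ℂ)) ⊆
      charProd hn {χ : AddChar (Fin m₁ → ZMod 2) ℂ | charDeg χ ≤ d} S₂) :
    HasFSOS f
      (charProd hn
        {χ : AddChar (Fin m₁ → ZMod 2) ℂ | (charDeg χ : ℤ) ≤ ⌈((m₁ : ℚ) + (d : ℚ) - 1) / 2⌉}
        (Subgroup.closure S₂ : Set (AddChar (Fin m₂ → ZMod 2) ℂ))) := by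
  subst hn
  set r : ℤ := ⌈((m₁ : ℚ) + (d : ℚ) - 1) / 2⌉ with hr
  have hr2 : (m₁ : ℤ) + d - 1 ≤ 2 * r := by
    have h := Int.le_ceil (((m₁ : ℚ) + (d : ℚ) - 1) / 2)
    rw [← hr, div_le_iff₀ (by norm_num)] at h
    have : (m₁ : ℚ) + d - 1 ≤ 2 * r := by linarith
    exact_mod_cast this
  let η : AddChar (Fin (m₁ + m₂) → ZMod 2) ℂ := (fullChar m₁).compAddMonoidHom (projFirst rfl)
  have hη₁ : ∀ t : AddChar (Fin (m₁ + m₂) → ZMod 2) ℂ,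
      (η * t).compAddMonoidHom (inclFirst m₁ m₂) =
        fullChar m₁ * t.compAddMonoidHom (inclFirst m₁ m₂) := by
    intro t
    ext y
    have h : projFirst rfl (inclFirst m₁ m₂ y) = y := by
      funext i; simp [projFirst, inclFirst]
    simp [η, AddChar.mul_apply, h]
  have hη₂ : ∀ t : AddChar (Fin (m₁ + m₂) → ZMod 2) ℂ,
      (η * t).compAddMonoidHom (inclLast m₁ m₂) = t.compAddMonoidHom (inclLast m₁ m₂) := by
    intro t
    ext y
    have h : projFirst rfl (inclLast m₁ m₂ y) = 0 := by
      funext i; simp [projFirst, inclLast]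
    simp [η, AddChar.mul_apply, h]
  refine hasFSOS_of_separated hf (lastSubgroup m₁ (Subgroup.closure S₂))
    (fun χ hχ => Subgroup.subset_closure (mem_charProd_iff.mp (hsupp hχ)).2) _ η
    fun s hs t ht hsT htT => ?_
  by_contra hne
  have hd := (mem_charProd_iff.mp (hsupp hne)).1
  have hdiv : (s / t).compAddMonoidHom (inclFirst m₁ m₂) =
      s.compAddMonoidHom (inclFirst m₁ m₂) / t.compAddMonoidHom (inclFirst m₁ m₂) := by
    ext y
    simp only [AddChar.compAddMonoidHom_apply, AddChar.div_apply']
  rw [Set.mem_ofPred_eq, hdiv] at hd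
  have hs' : r < charDeg (s.compAddMonoidHom (inclFirst m₁ m₂)) := by
    by_contra! h
    exact hsT (mem_charProd_iff.mpr ⟨h, hs⟩)
  have ht' : r < charDeg (fullChar m₁ * t.compAddMonoidHom (inclFirst m₁ m₂)) := by
    by_contra! h
    refine htT (mem_charProd_iff.mpr ⟨?_, ?_⟩)
    · rw [hη₁]; exact h
    · rw [hη₂]; exact ht
  have h1 := charDeg_fullChar_mul_add (t.compAddMonoidHom (inclFirst m₁ m₂))
  have h2 := charDeg_le_add_charDeg_div (s.compAddMonoidHom (inclFirst m₁ m₂))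
    (t.compAddMonoidHom (inclFirst m₁ m₂))
  -- The degree of `s / t` on the first block is at least `(r + 1) - (m₁ - r - 1) = 2r + 2 - m₁ ≥ d
  -- + 1`, contradicting `hd`.
  omega
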